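/- Let $k\ge 6$ be an integer. In \emph{multicolored induced $k$-edge path detection}, the input is a graph $G$ on $n$ nodes with a (not necessarily proper) coloring of its nodes with $k+1$ colors, each node knowing its own color, and the task is to decide whether $G$ contains an induced path with $k$ edges (that is, $k+1$ nodes) all of whose nodes have different colors. The problem is considered in the $\mathsf{CONGEST}$ model. The input graph is the communication graph; nodes have unique identifiers $0,\dots,n-1$ and initially know $n$, $k$, their identifier, the identifiers of their neighbors, and their color. Computation proceeds in synchronous rounds. In each round every node may send to each of its neighbors a (possibly different) message of at most $B$ bits, where $B=O(\log n)$, and local computation is unrestricted. Algorithms may use randomness, private or shared. An algorithm solves the problem in $T$ rounds on $n$-node graphs if for every input graph and coloring, with probability at least $2/3$, after $T$ rounds at least one node reports a yes-instance if the input is a yes-instance, and no node does so otherwise. \textbf{Theorem.} For any $k\ge 6$, any $\mathsf{CONGEST}$ algorithm solving multicolored induced $k$-edge path detection needs $\Omega(n/\log n)$ rounds. Precisely: for every $k\ge 6$ and every $\beta>0$ there are $c>0$ and $n_0$ such that for every $n\ge n_0$, every (deterministic or randomized) algorithm with bandwidth $B\le\beta\log n$ that solves the problem in $T$ rounds on $n$-node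 graphs satisfies $T\ge c\,n/\log n$. -/

import Mathlib

open MeasureTheory

/-- `G`, with the (not necessarily proper) node coloring `χ`, contains a multicolored induced copy
of the pattern `H`: an induced copy all of whose nodes have different colors. -/
def HasMulticoloredInducedCopy {W V C : Type*} (H : SimpleGraph W) (G : SimpleGraph V)
    (χ : V → C) : Prop :=
  ∃ f : H ↪g G, Function.Injective fun w => χ (f w)

/-- The pattern with `k` edges (hence `k + 1` nodes) that is a path; the input graph is colored
with as many colors as the pattern has nodes. -/
def HasMulticoloredInducedPath {V : Type*} (k : ℕ) (G : SimpleGraph V)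
    (χ : V → Fin (k + 1)) : Prop :=
  HasMulticoloredInducedCopy (SimpleGraph.pathGraph (k + 1)) G χ

/-- Messages: bit strings of length at most `B` (the empty string stands for silence). -/
abbrev CongestMessage (B : ℕ) : Type := {w : List Bool // w.length ≤ B}

/-- A (randomized) algorithm in the CONGEST model with bandwidth `B`, on communication graphs with
`n` nodes; the nodes carry the identifiers `0, …, n - 1`, and every node has a local input in `I`.

A node starts with the knowledge of `n`, its identifier, the identifiers of its neighbors, its
local input and the random seed `ω : Ω`. In each round it sends to each of its neighbors a message
that is a function of its local state, and then updates its state from the messages received.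
Local computation is unrestricted. The seed may be used by all nodes; independent private coins
are the case where `Ω` is a product over the nodes and node `v` reads the coordinate `v` only, and
deterministic algorithms are the case where the seed is ignored. -/
structure CongestAlgorithm (I : Type) (n B : ℕ) (Ω : Type) where
  /-- Local states of a node. -/
  State : Type
  /-- Initial state, from identifier, set of neighbors, local input and seed. -/
  init : Fin n → Set (Fin n) → I → Ω → State
  /-- The message sent to the neighbor with the given identifier. -/
  send : State → Fin n → CongestMessage B
  /-- State update; the messages received are indexed by the identifier of the sender, with
  `none` for those nodes that are not neighbors. -/
  receive : State → (Fin n → Option (CongestMessage B)) → State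
  /-- Whether a node in this state reports that the input is a yes-instance. -/
  output : State → Bool

namespace CongestAlgorithm

variable {I Ω : Type} {n B : ℕ}

open Classical in
/-- The local state of each node after `t` synchronous rounds on the graph `G` with local inputs
`x` and seed `ω`. -/
noncomputable def run (A : CongestAlgorithm I n B Ω) (G : SimpleGraph (Fin n)) (x : Fin n → I)
    (ω : Ω) : ℕ → Fin n → A.State
  | 0, v => A.init v (G.neighborSet v) (x v) ω
  | t + 1, v => A.receive (A.run G x ω t v) fun u =>
      if G.Adj v u then some (A.send (A.run G x ω t u) v) else none

/-- After `T` rounds at least one node reports a yes-instance. -/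
def Reports (A : CongestAlgorithm I n B Ω) (G : SimpleGraph (Fin n)) (x : Fin n → I)
    (T : ℕ) (ω : Ω) : Prop :=
  ∃ v, A.output (A.run G x ω T v) = true

/-- `A` solves the decision problem `P` in `T` rounds, with probability at least `2 / 3` on every
input: on yes-instances some node reports it, on no-instances no node does. (Requiring moreover
that particular nodes, or all nodes, report a yes-instance gives a more demanding notion, met by
fewer algorithms.) -/
def Solves [MeasurableSpace Ω] (A : CongestAlgorithm I n B Ω) (μ : Measure Ω)
    (P : SimpleGraph (Fin n) → (Fin n → I) → Prop) (T : ℕ) : Prop :=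
  ∀ (G : SimpleGraph (Fin n)) (x : Fin n → I), μ {ω | ¬ (A.Reports G x T ω ↔ P G x)} ≤ 1 / 3

end CongestAlgorithm

/-!
The bound comes from the hardness of set disjointness. Fix `m ≈ n / (k + 1)` indices and let the
color classes be copies of the index set. Consecutive classes are joined completely, except for
matchings of equal indices between the classes `1, 2` and between `4, 5`; the complement of
`x ⊆ [m]²` is placed between the classes `2, 4`, that of `y ⊆ [m]²` between `1, 5`. Every
multicolored induced path must run through the colors in order, since the other edges would create
a triangle, a node of degree three, or a disconnected graph. So it picks one index `j` in the
classes `1, 2` and one index `i` in `4, 5`, and it exists if and only if some `(j, i)` lies in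
`x ∩ y`. Only the matching edges, at most `n` of them, join the classes `2, 3, 4` to the rest:
two parties holding `x` and `y` simulate an algorithm by exchanging `O(B * n)` bits per round.

Disjointness on `N = m²` elements is hard by a corruption argument. For a fixed seed the outcomes
of the simulation partition the inputs into rectangles `a × b`. Draw a disjoint pair from a random
split of the ground set. By a Chernoff bound, if a rectangle has probability larger than
`exp (-Ω(N))` inside a split, only few elements are rare in the sense that joining them to the set
lowers that probability noticeably. Joining an element that is rare for neither `a` nor `b` to both
sets turns the disjoint pair into a crossing pair at the cost of a constant factor. Hence
rectangles that accept most disjoint pairs also accept many crossing pairs, unless there are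
`exp (Ω(N))` of them, which gives `B * n * T = Ω(N) = Ω(n²)`.
-/

open Finset
open scoped BigOperators

section CubeAverages

variable {ι : Type*} [Fintype ι] [DecidableEq ι]

lemma expect_eq_half_erase_add_insert (i : ι) (f : Finset ι → ℝ) :
    𝔼 u, f u = (𝔼 u : Finset ι, f (u.erase i) + 𝔼 u, f (insert i u)) / 2 := by
  have flip : 𝔼 u, f (symmDiff u {i}) = 𝔼 u, f u :=
    Fintype.expect_bijective _ (symmDiff_left_involutive {i}).bijective _ _ fun _ => rfl
  have pair (u : Finset ι) : f (u.erase i) + f (insert i u) = f u + f (symmDiff u {i}) := by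
    by_cases h : i ∈ u
    · have : symmDiff u {i} = u.erase i := by ext; grind [mem_symmDiff]
      rw [this, insert_eq_of_mem h, add_comm]
    · have : symmDiff u {i} = insert i u := by ext; grind [mem_symmDiff]
      rw [this, erase_eq_of_notMem h]
  rw [← expect_add_distrib]
  simp only [pair]
  rw [expect_add_distrib, flip]
  ring

lemma expect_ite_mem_eq_half (i : ι) (f : Finset ι → ℝ) :
    𝔼 u, (if i ∈ u then f u else 0) = (𝔼 u, f (insert i u)) / 2 := by
  rw [expect_eq_half_erase_add_insert i]
  simp

lemma expect_eq_two_mul_expect_ite_mem (i : ι) (f : Finset ι → ℝ)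
    (hf : ∀ u, f (insert i u) = f u) : 𝔼 u, f u = 2 * 𝔼 u, if i ∈ u then f u else 0 := by
  rw [expect_ite_mem_eq_half]
  simp only [hf]
  ring

lemma expect_compl (f : Finset ι → ℝ) : 𝔼 u, f uᶜ = 𝔼 u, f u :=
  Fintype.expect_bijective _ compl_involutive.bijective _ _ fun _ => rfl

lemma expect_exp_mul_half_card_sub_card_inter_le (t : ℝ) (S : Finset ι) :
    𝔼 u : Finset ι, Real.exp (t * (#S / 2 - #(u ∩ S))) ≤ Real.exp (t ^ 2 / 8 * #S) := by
  induction S using Finset.induction_on with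
  | empty => simp
  | insert i S hi ih =>
    set X : Finset ι → ℝ := fun u => Real.exp (t * (#S / 2 - #(u ∩ S))) with hX
    have erased (u : Finset ι) :
        Real.exp (t * (#(insert i S) / 2 - #(u.erase i ∩ insert i S))) =
          Real.exp (t / 2) * X u := by
      have : u.erase i ∩ insert i S = u ∩ S := by grind
      rw [this, card_insert_of_notMem hi, hX, ← Real.exp_add]
      push_cast
      ring_nf
    have inserted (u : Finset ι) :
        Real.exp (t * (#(insert i S) / 2 - #(insert i u ∩ insert i S))) =
          Real.exp (-(t / 2)) * X u := by
      rw [← insert_inter_distrib, card_insert_of_notMem hi,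
        card_insert_of_notMem (fun h => hi (mem_of_mem_inter_right h)), hX, ← Real.exp_add]
      push_cast
      ring_nf
    rw [expect_eq_half_erase_add_insert i]
    simp only [erased, inserted, ← mul_expect]
    calc (Real.exp (t / 2) * 𝔼 u, X u + Real.exp (-(t / 2)) * 𝔼 u, X u) / 2
        = Real.cosh (t / 2) * 𝔼 u, X u := by rw [Real.cosh_eq]; ring
      _ ≤ Real.exp ((t / 2) ^ 2 / 2) * Real.exp (t ^ 2 / 8 * #S) := by
          gcongr
          exact Real.cosh_le_exp_half_sq _
      _ = Real.exp (t ^ 2 / 8 * #(insert i S)) := by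
          rw [card_insert_of_notMem hi, ← Real.exp_add]
          push_cast
          ring_nf

lemma expect_le_exp_of_forall_biased {a : Finset ι → ℝ} (ha : ∀ u, 0 ≤ a u) (ha' : ∀ u, a u ≤ 1)
    {S : Finset ι} {ε : ℝ} (hε : 0 ≤ ε)
    (hS : ∀ i ∈ S, 𝔼 u, (if i ∈ u then a u else 0) ≤ (1 / 2 - ε) * 𝔼 u, a u) :
    𝔼 u, a u ≤ Real.exp (-(2 * ε ^ 2 * #S)) := by
  set X : Finset ι → ℝ := fun u => #S / 2 - #(u ∩ S) with hX
  have card_eq (u : Finset ι) : (#(u ∩ S) : ℝ) * a u = ∑ i ∈ S, if i ∈ u then a u else 0 := by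
    rw [← sum_filter, sum_const, nsmul_eq_mul, inter_comm, filter_mem_eq_inter]
  have mean_card : 𝔼 u, #(u ∩ S) * a u ≤ #S * ((1 / 2 - ε) * 𝔼 u, a u) := by
    simp only [card_eq]
    rw [expect_sum_comm, ← nsmul_eq_mul]
    exact sum_le_card_nsmul _ _ _ hS
  have mean_deviation : 0 ≤ 𝔼 u, a u * (X u - ε * #S) := by
    have : 𝔼 u, a u * (X u - ε * #S) =
        #S * ((1 / 2 - ε) * 𝔼 u, a u) - 𝔼 u, #(u ∩ S) * a u := by
      rw [mul_expect, mul_expect, ← expect_sub_distrib]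
      exact expect_congr rfl fun u _ => by rw [hX]; ring
    linarith
  -- The Chernoff exponent `4 * ε` minimizes the final bound `t ^ 2 / 8 - t * ε`.
  have tangent (u : Finset ι) :
      a u + 4 * ε * (a u * (X u - ε * #S)) ≤
        Real.exp (-(4 * ε ^ 2 * #S)) * Real.exp (4 * ε * X u) := by
    rw [← Real.exp_add]
    calc a u + 4 * ε * (a u * (X u - ε * #S))
        = a u * (4 * ε * (X u - ε * #S) + 1) := by ring
      _ ≤ a u * Real.exp (4 * ε * (X u - ε * #S)) :=
          mul_le_mul_of_nonneg_left (Real.add_one_le_exp _) (ha u)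
      _ ≤ 1 * Real.exp (4 * ε * (X u - ε * #S)) := by gcongr; exact ha' u
      _ = _ := by rw [one_mul]; ring_nf
  calc 𝔼 u, a u ≤ 𝔼 u, a u + 4 * ε * 𝔼 u, a u * (X u - ε * #S) :=
        le_add_of_nonneg_right (by positivity)
    _ = 𝔼 u, (a u + 4 * ε * (a u * (X u - ε * #S))) := by
        rw [expect_add_distrib, mul_expect]
    _ ≤ 𝔼 u, Real.exp (-(4 * ε ^ 2 * #S)) * Real.exp (4 * ε * X u) :=
        expect_le_expect fun u _ => tangent u
    _ = Real.exp (-(4 * ε ^ 2 * #S)) * 𝔼 u, Real.exp (4 * ε * X u) := by rw [mul_expect]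
    _ ≤ Real.exp (-(4 * ε ^ 2 * #S)) * Real.exp ((4 * ε) ^ 2 / 8 * #S) := by
        gcongr
        exact expect_exp_mul_half_card_sub_card_inter_le _ _
    _ = Real.exp (-(2 * ε ^ 2 * #S)) := by rw [← Real.exp_add]; ring_nf

end CubeAverages

section SubsetAverages

variable {ι : Type*} [Fintype ι] [DecidableEq ι]

/-- The average of `a` over the subsets of `d`. It is written as an average over all sets, so that
averages for different `d` range over the same index set. -/
noncomputable def subsetAvg (a : Finset ι → ℝ) (d : Finset ι) : ℝ := 𝔼 u, a (u ∩ d)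

lemma subsetAvg_nonneg {a : Finset ι → ℝ} (ha : ∀ u, 0 ≤ a u) (d : Finset ι) :
    0 ≤ subsetAvg a d :=
  expect_nonneg fun _ _ => ha _

lemma subsetAvg_le_one {a : Finset ι → ℝ} (ha : ∀ u, a u ≤ 1) (d : Finset ι) :
    subsetAvg a d ≤ 1 :=
  expect_le univ_nonempty fun _ _ => ha _

lemma subsetAvg_mul_subsetAvg (a b : Finset ι → ℝ) (c d : Finset ι) :
    subsetAvg a c * subsetAvg b d = 𝔼 u, 𝔼 v, a (u ∩ c) * b (v ∩ d) :=
  expect_mul_expect _ _ _ _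

lemma subsetAvg_comp_insert_insert (a : Finset ι → ℝ) (i : ι) (d : Finset ι) :
    subsetAvg (fun u => a (insert i u)) (insert i d) = subsetAvg (fun u => a (insert i u)) d := by
  refine expect_congr rfl fun u _ => congrArg a ?_
  grind

lemma subsetAvg_eq_half {i : ι} {d : Finset ι} (hi : i ∈ d) (a : Finset ι → ℝ) :
    subsetAvg a d =
      (subsetAvg a (d.erase i) + subsetAvg (fun u => a (insert i u)) d) / 2 := by
  have erased (u : Finset ι) : u.erase i ∩ d = u ∩ d.erase i := by grind
  have inserted (u : Finset ι) : insert i u ∩ d = insert i (u ∩ d) := insert_inter_of_mem hi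
  simp only [subsetAvg]
  rw [expect_eq_half_erase_add_insert i]
  simp only [erased, inserted]

lemma expect_ite_mem_subset_eq_half {i : ι} {d : Finset ι} (hi : i ∈ d) (a : Finset ι → ℝ) :
    𝔼 u, (if i ∈ u then a (u ∩ d) else 0) = subsetAvg (fun u => a (insert i u)) d / 2 := by
  rw [expect_ite_mem_eq_half]
  simp only [insert_inter_of_mem hi, subsetAvg]

/-- Element `i` is rare for `a` within `d` if joining `i` to a random subset of `d` that avoids it
lowers the average of `a` by a constant factor. -/
def IsRare (a : Finset ι → ℝ) (d : Finset ι) (i : ι) : Prop :=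
  subsetAvg (fun u => a (insert i u)) d < 9 / 10 * subsetAvg a (d.erase i)

lemma isRare_insert (a : Finset ι → ℝ) (d : Finset ι) (i : ι) :
    IsRare a (insert i d) i ↔ IsRare a d i := by
  rw [IsRare, IsRare, subsetAvg_comp_insert_insert, erase_insert_eq_erase]

open Classical in
lemma subsetAvg_mul_card_isRare_le {a : Finset ι → ℝ} (ha : ∀ u, 0 ≤ a u) (ha' : ∀ u, a u ≤ 1)
    (d : Finset ι) {γ : ℝ} (hγ : 0 ≤ γ) :
    subsetAvg a d * #{i ∈ d | IsRare a d i} ≤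
      (γ * subsetAvg a d + Real.exp (-(γ * Fintype.card ι / 722))) * Fintype.card ι := by
  set S : Finset ι := {i ∈ d | IsRare a d i} with hS
  have avg_nonneg := subsetAvg_nonneg ha d
  rcases le_total (#S : ℝ) (γ * Fintype.card ι) with few | many
  · calc subsetAvg a d * #S ≤ subsetAvg a d * (γ * Fintype.card ι) := by gcongr
      _ = (γ * subsetAvg a d + 0) * Fintype.card ι := by ring
      _ ≤ _ := by gcongr; positivity
  · -- A rare element has conditional probability at most `(9/10) / (1 + 9/10) = 1/2 - 1/38`.
    have biased (i : ι) (hi : i ∈ S) :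
        𝔼 u, (if i ∈ u then a (u ∩ d) else 0) ≤ (1 / 2 - 1 / 38) * subsetAvg a d := by
      obtain ⟨hid, rare⟩ := mem_filter.1 hi
      rw [expect_ite_mem_subset_eq_half hid, subsetAvg_eq_half hid a]
      unfold IsRare at rare
      linarith
    have small : subsetAvg a d ≤ Real.exp (-(2 * (1 / 38) ^ 2 * #S)) :=
      expect_le_exp_of_forall_biased (fun u => ha _) (fun u => ha' _) (by norm_num) biased
    calc subsetAvg a d * #S
        ≤ Real.exp (-(2 * (1 / 38) ^ 2 * #S)) * Fintype.card ι := by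
          gcongr
          exact card_le_univ S
      _ ≤ Real.exp (-(γ * Fintype.card ι / 722)) * Fintype.card ι := by
          gcongr
          linarith
      _ ≤ _ := by
          gcongr
          exact le_add_of_nonneg_left (mul_nonneg hγ avg_nonneg)

open Classical in
lemma expect_isRare_mul_le [Nonempty ι] {a b : Finset ι → ℝ} (ha : ∀ u, 0 ≤ a u)
    (ha' : ∀ u, a u ≤ 1) (hb : ∀ u, 0 ≤ b u) (hb' : ∀ u, b u ≤ 1) {γ : ℝ} (hγ : 0 ≤ γ) :
    𝔼 i, 𝔼 d, (if IsRare a d i then subsetAvg a (d.erase i) * subsetAvg b (dᶜ.erase i) else 0) ≤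
      4 * (γ * 𝔼 d, subsetAvg a d * subsetAvg b dᶜ
        + Real.exp (-(γ * Fintype.card ι / 722))) := by
  set e := Real.exp (-(γ * Fintype.card ι / 722))
  have average_within (i : ι) :
      𝔼 d, (if IsRare a d i then subsetAvg a (d.erase i) * subsetAvg b (dᶜ.erase i) else 0) ≤
        𝔼 d, if i ∈ d ∧ IsRare a d i then 4 * (subsetAvg a d * subsetAvg b dᶜ) else 0 := by
    rw [expect_eq_two_mul_expect_ite_mem i, mul_expect]
    · refine expect_le_expect fun d _ => ?_
      by_cases hid : i ∈ d
      · have erased_le : subsetAvg a (d.erase i) ≤ 2 * subsetAvg a d := by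
          linarith [subsetAvg_eq_half hid a, subsetAvg_nonneg (fun u => ha (insert i u)) d]
        have compl_erase : dᶜ.erase i = dᶜ := erase_eq_of_notMem (by simpa using hid)
        have := mul_le_mul_of_nonneg_right erased_le (subsetAvg_nonneg hb dᶜ)
        simp only [hid, compl_erase, if_true, true_and]
        split_ifs <;> linarith
      · simp [hid]
    · intro d
      simp only [isRare_insert, erase_insert_eq_erase, compl_insert, erase_idem]
  have card_bound (d : Finset ι) :
      𝔼 i, (if i ∈ d ∧ IsRare a d i then 4 * (subsetAvg a d * subsetAvg b dᶜ) else 0) ≤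
        4 * (γ * (subsetAvg a d * subsetAvg b dᶜ) + e) := by
    have card_pos : (0 : ℝ) < Fintype.card ι := by exact_mod_cast Fintype.card_pos
    have few_rare : subsetAvg a d * #{i ∈ d | IsRare a d i} * subsetAvg b dᶜ ≤
        (γ * subsetAvg a d + e) * Fintype.card ι * subsetAvg b dᶜ :=
      mul_le_mul_of_nonneg_right (subsetAvg_mul_card_isRare_le ha ha' d hγ) (subsetAvg_nonneg hb dᶜ)
    have error_le : subsetAvg b dᶜ * e * Fintype.card ι ≤ 1 * e * Fintype.card ι := by
      gcongr
      exact subsetAvg_le_one hb' _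
    rw [Fintype.expect_eq_sum_div_card, div_le_iff₀ card_pos, ← sum_filter, sum_const,
      nsmul_eq_mul, filter_and, filter_univ_mem, inter_filter, inter_univ]
    linarith
  calc _ ≤ 𝔼 i, 𝔼 d, if i ∈ d ∧ IsRare a d i then 4 * (subsetAvg a d * subsetAvg b dᶜ) else 0 :=
        expect_le_expect fun i _ => average_within i
    _ = 𝔼 d, 𝔼 i, if i ∈ d ∧ IsRare a d i then 4 * (subsetAvg a d * subsetAvg b dᶜ) else 0 :=
        expect_comm _ _ _
    _ ≤ 𝔼 d, 4 * (γ * (subsetAvg a d * subsetAvg b dᶜ) + e) :=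
        expect_le_expect fun d _ => card_bound d
    _ = _ := by
        rw [← mul_expect, expect_add_distrib, ← mul_expect, expect_const univ_nonempty]

open Classical in
lemma expect_isRare_compl_mul_le [Nonempty ι] {a b : Finset ι → ℝ} (ha : ∀ u, 0 ≤ a u)
    (ha' : ∀ u, a u ≤ 1) (hb : ∀ u, 0 ≤ b u) (hb' : ∀ u, b u ≤ 1) {γ : ℝ} (hγ : 0 ≤ γ) :
    𝔼 i, 𝔼 d, (if IsRare b dᶜ i then subsetAvg a (d.erase i) * subsetAvg b (dᶜ.erase i) else 0) ≤
      4 * (γ * 𝔼 d, subsetAvg a d * subsetAvg b dᶜ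
        + Real.exp (-(γ * Fintype.card ι / 722))) := by
  calc _ = 𝔼 i, 𝔼 d,
          if IsRare b d i then subsetAvg b (d.erase i) * subsetAvg a (dᶜ.erase i) else 0 := by
        refine expect_congr rfl fun i _ => ?_
        rw [← expect_compl]
        simp only [compl_compl, mul_comm]
    _ ≤ 4 * (γ * 𝔼 d, subsetAvg b d * subsetAvg a dᶜ
          + Real.exp (-(γ * Fintype.card ι / 722))) := expect_isRare_mul_le hb hb' ha ha' hγ
    _ = _ := by
        rw [← expect_compl]
        simp only [compl_compl, mul_comm]

open Classical in
lemma subsetAvg_mul_erase_sub_isRare_le_insert {a b : Finset ι → ℝ} (ha : ∀ u, 0 ≤ a u)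
    (hb : ∀ u, 0 ≤ b u) (i : ι) (c d : Finset ι) :
    (9 / 10) ^ 2 * (subsetAvg a (c.erase i) * subsetAvg b (d.erase i)
        - (if IsRare a c i then subsetAvg a (c.erase i) * subsetAvg b (d.erase i) else 0)
        - if IsRare b d i then subsetAvg a (c.erase i) * subsetAvg b (d.erase i) else 0) ≤
      subsetAvg (fun u => a (insert i u)) c * subsetAvg (fun v => b (insert i v)) d := by
  have a_nonneg := subsetAvg_nonneg ha (c.erase i)
  have b_nonneg := subsetAvg_nonneg hb (d.erase i)
  have insert_nonneg := mul_nonneg (subsetAvg_nonneg (fun u => ha (insert i u)) c)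
    (subsetAvg_nonneg (fun v => hb (insert i v)) d)
  by_cases rare : IsRare a c i ∨ IsRare b d i
  · have erase_nonneg := mul_nonneg a_nonneg b_nonneg
    refine le_trans ?_ insert_nonneg
    rcases rare with h | h <;> simp only [h, if_true] <;> split_ifs <;> linarith
  · obtain ⟨a_common, b_common⟩ := not_or.1 rare
    rw [if_neg a_common, if_neg b_common]
    rw [IsRare, not_lt] at a_common b_common
    calc _ = (9 / 10 * subsetAvg a (c.erase i)) * (9 / 10 * subsetAvg b (d.erase i)) := by ring
      _ ≤ _ := by
          gcongr
          exact subsetAvg_nonneg (fun u => ha (insert i u)) c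

lemma expect_subsetAvg_mul_erase_le_insert [Nonempty ι] {a b : Finset ι → ℝ}
    (ha : ∀ u, 0 ≤ a u) (ha' : ∀ u, a u ≤ 1) (hb : ∀ u, 0 ≤ b u) (hb' : ∀ u, b u ≤ 1)
    {γ : ℝ} (hγ : 0 ≤ γ) :
    (9 / 10) ^ 2 * (𝔼 i, 𝔼 d : Finset ι, subsetAvg a (d.erase i) * subsetAvg b (dᶜ.erase i) -
        8 * (γ * 𝔼 d, subsetAvg a d * subsetAvg b dᶜ
          + Real.exp (-(γ * Fintype.card ι / 722)))) ≤
      𝔼 i, 𝔼 d, subsetAvg (fun u => a (insert i u)) d * subsetAvg (fun v => b (insert i v)) dᶜ := by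
  classical
  set P : ι → Finset ι → ℝ := fun i d => subsetAvg a (d.erase i) * subsetAvg b (dᶜ.erase i)
  have rare_left := expect_isRare_mul_le ha ha' hb hb' hγ
  have rare_right := expect_isRare_compl_mul_le ha ha' hb hb' hγ
  calc _ ≤ (9 / 10) ^ 2 * (𝔼 i, 𝔼 d, P i d - 𝔼 i, 𝔼 d, (if IsRare a d i then P i d else 0)
          - 𝔼 i, 𝔼 d, if IsRare b dᶜ i then P i d else 0) := by
        refine mul_le_mul_of_nonneg_left ?_ (by norm_num)
        linarith
    _ = 𝔼 i, 𝔼 d, (9 / 10) ^ 2 * (P i d - (if IsRare a d i then P i d else 0)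
          - if IsRare b dᶜ i then P i d else 0) := by
        simp only [← mul_expect, expect_sub_distrib]
    _ ≤ _ := expect_le_expect fun i _ => expect_le_expect fun d _ =>
        subsetAvg_mul_erase_sub_isRare_le_insert ha hb i d dᶜ

end SubsetAverages

section Disjointness

variable {ι : Type*} [Fintype ι] [DecidableEq ι]

/-- A disjoint pair of sets, drawn by splitting the ground set at random into `d` and `dᶜ` and
taking a random subset of each part, neither of them containing `i`. -/
def disjointPair (q : ι × Finset ι × Finset ι × Finset ι) : Finset ι × Finset ι :=
  (q.2.2.1 ∩ q.2.1.erase q.1, q.2.2.2 ∩ q.2.1ᶜ.erase q.1)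

/-- The pair that arises from a split of the ground set as in `disjointPair` by putting the
element `i` into both sets, which then meet in `i` only. -/
def crossingPair (q : ι × Finset ι × Finset ι × Finset ι) : Finset ι × Finset ι :=
  (insert q.1 (q.2.2.1 ∩ q.2.1), insert q.1 (q.2.2.2 ∩ q.2.1ᶜ))

lemma disjoint_disjointPair (q : ι × Finset ι × Finset ι × Finset ι) :
    Disjoint (disjointPair q).1 (disjointPair q).2 :=
  (disjoint_compl_right (a := q.2.1)).mono (inter_subset_right.trans (erase_subset _ _))
    (inter_subset_right.trans (erase_subset _ _))

lemma not_disjoint_crossingPair (q : ι × Finset ι × Finset ι × Finset ι) :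
    ¬ Disjoint (crossingPair q).1 (crossingPair q).2 :=
  not_disjoint_iff.2 ⟨q.1, mem_insert_self _ _, mem_insert_self _ _⟩

lemma expect_disjointPair (a b : Finset ι → ℝ) :
    𝔼 q, a (disjointPair q).1 * b (disjointPair q).2 =
      𝔼 i, 𝔼 d : Finset ι, subsetAvg a (d.erase i) * subsetAvg b (dᶜ.erase i) := by
  simp only [subsetAvg_mul_subsetAvg, ← univ_product_univ, expect_product, disjointPair]

lemma expect_crossingPair (a b : Finset ι → ℝ) :
    𝔼 q, a (crossingPair q).1 * b (crossingPair q).2 =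
      𝔼 i, 𝔼 d, subsetAvg (fun u => a (insert i u)) d * subsetAvg (fun v => b (insert i v)) dᶜ := by
  simp only [subsetAvg_mul_subsetAvg, ← univ_product_univ, expect_product, crossingPair]

lemma expect_disjointPair_le_expect_crossingPair [Nonempty ι] {Θ : Type*} (s : Finset Θ)
    {a b : Θ → Finset ι → ℝ} (ha : ∀ θ u, 0 ≤ a θ u) (ha' : ∀ θ u, a θ u ≤ 1)
    (hb : ∀ θ u, 0 ≤ b θ u) (hb' : ∀ θ u, b θ u ≤ 1)
    (hab : ∀ u v, ∑ θ ∈ s, a θ u * b θ v ≤ 1) {γ : ℝ} (hγ : 0 ≤ γ) :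
    (9 / 10) ^ 2 * (𝔼 q, ∑ θ ∈ s, a θ (disjointPair q).1 * b θ (disjointPair q).2 -
        8 * (γ + #s * Real.exp (-(γ * Fintype.card ι / 722)))) ≤
      𝔼 q, ∑ θ ∈ s, a θ (crossingPair q).1 * b θ (crossingPair q).2 := by
  set e := Real.exp (-(γ * Fintype.card ι / 722))
  have total : ∑ θ ∈ s, 𝔼 d, subsetAvg (a θ) d * subsetAvg (b θ) dᶜ ≤ 1 := by
    rw [← expect_sum_comm]
    refine expect_le univ_nonempty fun d _ => ?_
    simp only [subsetAvg_mul_subsetAvg]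
    simp only [← expect_sum_comm]
    exact expect_le univ_nonempty fun u _ => expect_le univ_nonempty fun v _ => hab _ _
  calc _ ≤ (9 / 10) ^ 2 * (∑ θ ∈ s, 𝔼 q, a θ (disjointPair q).1 * b θ (disjointPair q).2 -
          8 * (γ * ∑ θ ∈ s, 𝔼 d, subsetAvg (a θ) d * subsetAvg (b θ) dᶜ + #s * e)) := by
        rw [expect_sum_comm]
        gcongr
        exact mul_le_of_le_one_right hγ total
    _ = ∑ θ ∈ s, (9 / 10) ^ 2 * (𝔼 q, a θ (disjointPair q).1 * b θ (disjointPair q).2 -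
          8 * (γ * 𝔼 d, subsetAvg (a θ) d * subsetAvg (b θ) dᶜ + e)) := by
        rw [← mul_sum, sum_sub_distrib, ← mul_sum, sum_add_distrib, ← mul_sum, sum_const,
          nsmul_eq_mul]
    _ ≤ ∑ θ ∈ s, 𝔼 q, a θ (crossingPair q).1 * b θ (crossingPair q).2 := by
        refine sum_le_sum fun θ _ => ?_
        rw [expect_disjointPair, expect_crossingPair]
        exact expect_subsetAvg_mul_erase_le_insert (ha θ) (ha' θ) (hb θ) (hb' θ) hγ
    _ = _ := (expect_sum_comm _ _ _).symm

/-- The fibres of `τ` are combinatorial rectangles, as is the case for the transcript of a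
two-party communication protocol with inputs in `X` and `Y`. -/
def IsRectangular {X Y Θ : Type*} (τ : X → Y → Θ) : Prop :=
  ∀ ⦃x x' y y'⦄, τ x y = τ x' y' → τ x y' = τ x y

lemma IsRectangular.sum_indicator_mul_indicator {X Y Θ : Type*} {τ : X → Y → Θ}
    (hτ : IsRectangular τ) (s : Finset Θ) (x : X) (y : Y) :
    ∑ θ ∈ s, Set.indicator {x | ∃ y, τ x y = θ} 1 x * Set.indicator {y | ∃ x, τ x y = θ} 1 y =
      Set.indicator (s : Set Θ) (1 : Θ → ℝ) (τ x y) := by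
  classical
  have rectangle (θ : Θ) : ((∃ y', τ x y' = θ) ∧ ∃ x', τ x' y = θ) ↔ τ x y = θ := by
    constructor
    · rintro ⟨⟨y', rfl⟩, x', h⟩
      exact hτ h.symm
    · exact fun h => ⟨⟨y, h⟩, x, h⟩
  have product (θ : Θ) :
      Set.indicator {x | ∃ y, τ x y = θ} 1 x * Set.indicator {y | ∃ x, τ x y = θ} 1 y =
        if τ x y = θ then (1 : ℝ) else 0 := by
    simp only [← rectangle, ite_and, Set.indicator_apply, Set.mem_ofPred_eq, Pi.one_apply, ite_mul,
      one_mul, zero_mul]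
  simp only [product, sum_ite_eq]
  simp only [Set.indicator_apply, mem_coe, Pi.one_apply]

lemma IsRectangular.le_expect_error [Nonempty ι] {Θ : Type*} [Fintype Θ]
    {τ : Finset ι → Finset ι → Θ} (hτ : IsRectangular τ) (s : Set Θ) {γ : ℝ} (hγ : 0 ≤ γ) :
    (9 / 10) ^ 2 * (1 - 𝔼 q, s.indicator 1 (τ (disjointPair q).1 (disjointPair q).2) -
        8 * (γ + Fintype.card Θ * Real.exp (-(γ * Fintype.card ι / 722)))) ≤
      𝔼 q, sᶜ.indicator 1 (τ (crossingPair q).1 (crossingPair q).2) := by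
  classical
  have indicator_le (S : Set (Finset ι)) (u : Finset ι) : S.indicator (1 : Finset ι → ℝ) u ≤ 1 :=
    Set.indicator_apply_le' (fun _ => le_rfl) fun _ => zero_le_one
  have indicator_nonneg (S : Set (Finset ι)) (u : Finset ι) :
      0 ≤ S.indicator (1 : Finset ι → ℝ) u :=
    Set.indicator_apply_nonneg fun _ => zero_le_one
  have corruption := expect_disjointPair_le_expect_crossingPair sᶜ.toFinset
    (a := fun θ => Set.indicator {u | ∃ v, τ u v = θ} 1)
    (b := fun θ => Set.indicator {v | ∃ u, τ u v = θ} 1)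
    (fun _ => indicator_nonneg _) (fun _ => indicator_le _)
    (fun _ => indicator_nonneg _) (fun _ => indicator_le _)
    (fun u v => by
      rw [hτ.sum_indicator_mul_indicator]
      exact Set.indicator_apply_le' (fun _ => le_rfl) fun _ => zero_le_one) hγ
  simp only [hτ.sum_indicator_mul_indicator, Set.coe_toFinset] at corruption
  refine le_trans ?_ corruption
  have complement : 𝔼 q, s.indicator (1 : Θ → ℝ) (τ (disjointPair q).1 (disjointPair q).2) +
      𝔼 q, sᶜ.indicator (1 : Θ → ℝ) (τ (disjointPair q).1 (disjointPair q).2) = 1 := by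
    rw [← expect_add_distrib]
    simp only [Set.indicator_self_add_compl_apply, Pi.one_apply, expect_const univ_nonempty]
  have card_le : (#sᶜ.toFinset : ℝ) ≤ Fintype.card Θ := by exact_mod_cast card_le_univ _
  rw [← complement, add_sub_cancel_left]
  gcongr

lemma exists_expect_indicator_le {Ω X : Type*} [MeasurableSpace Ω] {μ : Measure Ω}
    [IsProbabilityMeasure μ] [Fintype X] [Nonempty X] {bad : X → Set Ω} {r : ℝ}
    (hbad : ∀ x, μ.real (bad x) ≤ r) :
    ∃ ω, 𝔼 x, (bad x).indicator 1 ω ≤ r := by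
  -- The events `bad x` need not be measurable, so the integral is taken over measurable hulls.
  have measurable (x : X) : MeasurableSet (toMeasurable μ (bad x)) := measurableSet_toMeasurable _ _
  have integrable (x : X) : Integrable ((toMeasurable μ (bad x)).indicator (1 : Ω → ℝ)) μ :=
    (integrable_const 1).indicator (measurable x)
  obtain ⟨ω, hω⟩ := exists_le_integral
    (integrable_finsetSum univ fun x (_ : x ∈ univ) => (integrable x).div_const (Fintype.card X))
  refine ⟨ω, ?_⟩
  calc 𝔼 x, (bad x).indicator 1 ω ≤ 𝔼 x, (toMeasurable μ (bad x)).indicator (1 : Ω → ℝ) ω :=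
        expect_le_expect fun x _ =>
          Set.indicator_le_indicator_of_subset (subset_toMeasurable μ _) (fun _ => zero_le_one) ω
    _ = ∑ x, (toMeasurable μ (bad x)).indicator (1 : Ω → ℝ) ω / Fintype.card X := by
        rw [Fintype.expect_eq_sum_div_card, sum_div]
    _ ≤ ∑ x, μ.real (bad x) / Fintype.card X := by
        refine hω.trans_eq ?_
        rw [integral_finsetSum _ fun x _ => (integrable x).div_const _]
        refine sum_congr rfl fun x _ => ?_
        rw [integral_div, integral_indicator_one (measurable x), measureReal_def,
          measure_toMeasurable, measureReal_def]
    _ = 𝔼 x, μ.real (bad x) := by rw [Fintype.expect_eq_sum_div_card, sum_div]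
    _ ≤ r := expect_le univ_nonempty fun x _ => hbad x

end Disjointness

theorem exp_le_card_of_disjointness {ι Ω Θ : Type*} [Fintype ι] [Nonempty ι] [MeasurableSpace Ω]
    {μ : Measure Ω} [IsProbabilityMeasure μ] [Fintype Θ] {τ : Ω → Finset ι → Finset ι → Θ}
    (hτ : ∀ ω, IsRectangular (τ ω)) (s : Set Θ)
    (hs : ∀ x y, μ {ω | ¬ (τ ω x y ∈ s ↔ ¬ Disjoint x y)} ≤ 1 / 3) :
    Real.exp (Fintype.card ι / 46208) ≤ 154 * Fintype.card Θ := by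
  classical
  let input (p : Bool × (ι × Finset ι × Finset ι × Finset ι)) : Finset ι × Finset ι :=
    if p.1 then crossingPair p.2 else disjointPair p.2
  obtain ⟨ω, hω⟩ := exists_expect_indicator_le (μ := μ) (r := 1 / 3)
    (bad := fun p => {ω | ¬ (τ ω (input p).1 (input p).2 ∈ s ↔
      ¬ Disjoint (input p).1 (input p).2)})
    fun p => ENNReal.toReal_le_of_le_ofReal (by norm_num) ((hs _ _).trans_eq (by
      rw [ENNReal.ofReal_div_of_pos three_pos]; simp))
  have split : 𝔼 p, Set.indicator {ω | ¬ (τ ω (input p).1 (input p).2 ∈ s ↔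
        ¬ Disjoint (input p).1 (input p).2)} (1 : Ω → ℝ) ω =
      (𝔼 q, sᶜ.indicator 1 (τ ω (crossingPair q).1 (crossingPair q).2) +
        𝔼 q, s.indicator 1 (τ ω (disjointPair q).1 (disjointPair q).2)) / 2 := by
    rw [← univ_product_univ, expect_product, Fintype.expect_eq_sum_div_card, Fintype.sum_bool]
    simp only [input, if_true, Bool.false_eq_true, if_false, disjoint_disjointPair,
      not_disjoint_crossingPair, not_true, not_false_iff, iff_true, iff_false, not_not,
      Fintype.card_bool, Nat.cast_ofNat]
    rfl
  -- The two errors add up to at most `2 / 3`, which is less than `(9/10)^2 * (1 - 8 * γ)` for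
  -- `γ = 1 / 64`; the difference of the two numbers yields the factor `154`.
  have corruption := (hτ ω).le_expect_error s (γ := 1 / 64) (by norm_num)
  rw [split] at hω
  have exp_neg : Real.exp (-(1 / 64 * Fintype.card ι / 722)) =
      (Real.exp (Fintype.card ι / 46208))⁻¹ := by
    rw [← Real.exp_neg]; ring_nf
  have inv_bound : 1 ≤ 154 * (Fintype.card Θ * (Real.exp (Fintype.card ι / 46208))⁻¹) := by
    rw [exp_neg] at corruption
    have : 0 ≤ 𝔼 q, s.indicator (1 : Θ → ℝ) (τ ω (disjointPair q).1 (disjointPair q).2) :=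
      expect_nonneg fun _ _ => Set.indicator_apply_nonneg fun _ => zero_le_one
    linarith
  rwa [← mul_assoc, ← div_eq_mul_inv, one_le_div (Real.exp_pos _)] at inv_bound

/-- The graphs `G x y` share a cut: the neighborhoods of the nodes in `side` depend on `x` only,
those of the other nodes on `y` only, and every edge between the two parts, in either orientation,
belongs to `cut`. This is what lets two parties, one knowing `x` and one knowing `y`, simulate an
algorithm on `G x y` by exchanging the messages sent along `cut`. -/
structure IsCutFamily {V X Y : Type*} (G : X → Y → SimpleGraph V) (side : Set V)
    (cut : Finset (V × V)) : Prop where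
  adj_left : ∀ x y y' {u v}, u ∈ side → ((G x y).Adj u v ↔ (G x y').Adj u v)
  adj_right : ∀ x x' y {u v}, u ∉ side → ((G x y).Adj u v ↔ (G x' y).Adj u v)
  mem_cut : ∀ {x y u v}, (G x y).Adj u v → (u ∈ side ↔ v ∉ side) → (u, v) ∈ cut

lemma IsCutFamily.comp {V X Y X' Y' : Type*} {G : X → Y → SimpleGraph V} {side : Set V}
    {cut : Finset (V × V)} (hG : IsCutFamily G side cut) (f : X' → X) (g : Y' → Y) :
    IsCutFamily (fun x y => G (f x) (g y)) side cut where
  adj_left x y y' := hG.adj_left (f x) (g y) (g y')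
  adj_right x x' y := hG.adj_right (f x) (f x') (g y)
  mem_cut := hG.mem_cut

namespace CongestAlgorithm

variable {I Ω : Type} {n B : ℕ} (A : CongestAlgorithm I n B Ω) (inp : Fin n → I)

lemma run_zero_congr {G G' : SimpleGraph (Fin n)} {u : Fin n}
    (hadj : ∀ v, G.Adj u v ↔ G'.Adj u v) (ω : Ω) : A.run G inp ω 0 u = A.run G' inp ω 0 u := by
  have : G.neighborSet u = G'.neighborSet u := Set.ext hadj
  rw [run, run, this]

lemma run_succ_congr {G G' : SimpleGraph (Fin n)} {u : Fin n} {ω : Ω} {t : ℕ}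
    (hadj : ∀ v, G.Adj u v ↔ G'.Adj u v) (hrun : A.run G inp ω t u = A.run G' inp ω t u)
    (hsend : ∀ v, G'.Adj u v → A.send (A.run G inp ω t v) u = A.send (A.run G' inp ω t v) u) :
    A.run G inp ω (t + 1) u = A.run G' inp ω (t + 1) u := by
  rw [run, run, hrun]
  congr 1
  funext v
  rw [hadj v]
  split_ifs with h
  · rw [hsend v h]
  · rfl

/-- The messages of the first `T` rounds along the edges in `cut`; for `(u, v) ∈ cut` this is what
`u` would send to `v`, whether or not the two nodes are adjacent. -/
noncomputable def cutTranscript (G : SimpleGraph (Fin n)) (ω : Ω) (T : ℕ)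
    (cut : Finset (Fin n × Fin n)) : Fin T → cut → CongestMessage B :=
  fun t e => A.send (A.run G inp ω t e.1.1) e.1.2

/-- After `T` rounds some node of `s` reports a yes-instance. -/
def ReportsIn (G : SimpleGraph (Fin n)) (T : ℕ) (ω : Ω) (s : Set (Fin n)) : Prop :=
  ∃ v ∈ s, A.output (A.run G inp ω T v) = true

lemma reports_iff_reportsIn (G : SimpleGraph (Fin n)) (T : ℕ) (ω : Ω) (s : Set (Fin n)) :
    A.Reports G inp T ω ↔ A.ReportsIn inp G T ω s ∨ A.ReportsIn inp G T ω sᶜ := by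
  simp only [Reports, ReportsIn, ← exists_or, ← or_and_right, Set.mem_compl_iff, em, true_and]

variable {X Y : Type*} {G : X → Y → SimpleGraph (Fin n)} {side : Set (Fin n)}
  {cut : Finset (Fin n × Fin n)} {ω : Ω} {T : ℕ} {x x' : X} {y y' : Y}

lemma run_eq_of_cutTranscript_eq (hG : IsCutFamily G side cut)
    (h : A.cutTranscript inp (G x y) ω T cut = A.cutTranscript inp (G x' y') ω T cut)
    {t : ℕ} (ht : t ≤ T) :
    (∀ u ∈ side, A.run (G x y') inp ω t u = A.run (G x y) inp ω t u) ∧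
      ∀ u ∉ side, A.run (G x y') inp ω t u = A.run (G x' y') inp ω t u := by
  induction t with
  | zero =>
    exact ⟨fun u hu => A.run_zero_congr inp (fun v => hG.adj_left x y' y hu) ω,
      fun u hu => A.run_zero_congr inp (fun v => hG.adj_right x x' y' hu) ω⟩
  | succ t ih =>
    obtain ⟨ih_left, ih_right⟩ := ih (by omega)
    have send_eq {u v : Fin n} (he : (u, v) ∈ cut) :
        A.send (A.run (G x y) inp ω t u) v = A.send (A.run (G x' y') inp ω t u) v :=
      congrFun (congrFun h ⟨t, ht⟩) ⟨(u, v), he⟩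
    refine ⟨fun u hu => A.run_succ_congr inp (fun v => hG.adj_left x y' y hu) (ih_left u hu)
      fun v hadj => ?_, fun u hu => A.run_succ_congr inp (fun v => hG.adj_right x x' y' hu)
      (ih_right u hu) fun v hadj => ?_⟩
    · by_cases hv : v ∈ side
      · rw [ih_left v hv]
      · rw [ih_right v hv, send_eq]
        exact hG.mem_cut hadj.symm (iff_of_false hv (not_not.2 hu))
    · by_cases hv : v ∈ side
      · rw [ih_left v hv, send_eq]
        exact hG.mem_cut hadj.symm (iff_of_true hv hu)
      · rw [ih_right v hv]

/-- What the two parties of the simulation know in the end: the messages along `cut`, and for each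
part of the nodes whether some node in it reports a yes-instance. -/
noncomputable def cutOutcome (G : SimpleGraph (Fin n)) (ω : Ω) (T : ℕ) (side : Set (Fin n))
    (cut : Finset (Fin n × Fin n)) : (Fin T → cut → CongestMessage B) × Prop × Prop :=
  (A.cutTranscript inp G ω T cut, A.ReportsIn inp G T ω side, A.ReportsIn inp G T ω sideᶜ)

lemma isRectangular_cutOutcome (hG : IsCutFamily G side cut) (ω : Ω) (T : ℕ) :
    IsRectangular fun x y => A.cutOutcome inp (G x y) ω T side cut := by
  intro x x' y y' h
  simp only [cutOutcome, Prod.mk.injEq] at h ⊢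
  obtain ⟨transcript_eq, -, right_eq⟩ := h
  have run_eq {t : ℕ} (ht : t ≤ T) := A.run_eq_of_cutTranscript_eq inp hG transcript_eq ht
  refine ⟨?_, ?_, ?_⟩
  · funext t ⟨⟨u, v⟩, he⟩
    by_cases hu : u ∈ side
    · exact congrArg (A.send · v) ((run_eq t.2.le).1 u hu)
    · refine (congrArg (A.send · v) ((run_eq t.2.le).2 u hu)).trans ?_
      exact (congrFun (congrFun transcript_eq t) ⟨(u, v), he⟩).symm
  · refine propext (exists_congr fun v => and_congr_right fun hv => ?_)
    rw [(run_eq le_rfl).1 v hv]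
  · rw [right_eq]
    refine propext (exists_congr fun v => and_congr_right fun hv => ?_)
    rw [(run_eq le_rfl).2 v hv]

end CongestAlgorithm

noncomputable instance CongestMessage.fintype (B : ℕ) : Fintype (CongestMessage B) :=
  have : Finite (CongestMessage B) := (List.finite_length_le Bool B).to_subtype
  Fintype.ofFinite _

lemma card_congestMessage_le (B : ℕ) : Fintype.card (CongestMessage B) ≤ 3 ^ B := by
  have injective : Function.Injective fun (w : CongestMessage B) (i : Fin B) => w.1[(i : ℕ)]? := by
    rintro ⟨w, hw⟩ ⟨w', hw'⟩ h
    refine Subtype.ext (List.ext_getElem? fun i => ?_)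
    by_cases hi : i < B
    · exact congrFun h ⟨i, hi⟩
    · rw [List.getElem?_eq_none (by simp only; omega), List.getElem?_eq_none (by simp only; omega)]
  simpa using Fintype.card_le_of_injective _ injective

theorem CongestAlgorithm.Solves.exp_le {ι I Ω : Type} [Fintype ι] [Nonempty ι] [MeasurableSpace Ω]
    {μ : Measure Ω} [IsProbabilityMeasure μ] {n B T : ℕ} {A : CongestAlgorithm I n B Ω}
    {P : SimpleGraph (Fin n) → (Fin n → I) → Prop} (hA : A.Solves μ P T)
    {G : Finset ι → Finset ι → SimpleGraph (Fin n)} {side : Set (Fin n)}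
    {cut : Finset (Fin n × Fin n)} (hG : IsCutFamily G side cut) {inp : Fin n → I}
    (hP : ∀ x y, P (G x y) inp ↔ ¬ Disjoint x y) :
    Real.exp (Fintype.card ι / 46208) ≤ 616 * 3 ^ (B * #cut * T) := by
  classical
  have solves_disjointness := exp_le_card_of_disjointness (μ := μ)
    (fun ω => A.isRectangular_cutOutcome inp hG ω T) {θ | θ.2.1 ∨ θ.2.2} fun x y => by
      have := hA (G x y) inp
      simp only [A.reports_iff_reportsIn inp _ T _ side, hP] at this
      exact this
  have card_messages : (Fintype.card (CongestMessage B) : ℝ) ≤ 3 ^ B := by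
    exact_mod_cast card_congestMessage_le B
  calc _ ≤ _ := solves_disjointness
    _ = 616 * ((Fintype.card (CongestMessage B) : ℝ) ^ #cut) ^ T := by
        simp only [Fintype.card_prod, Fintype.card_fun, Fintype.card_fin, Fintype.card_coe,
          Fintype.card_prop]
        push_cast
        ring
    _ ≤ 616 * ((3 ^ B) ^ #cut) ^ T := by gcongr
    _ = 616 * 3 ^ (B * #cut * T) := by rw [← pow_mul, ← pow_mul, mul_assoc]

section Gadget

lemma hasMulticoloredInducedPath_iff {V : Type*} {k : ℕ} {G : SimpleGraph V} {χ : V → Fin (k + 1)} :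
    HasMulticoloredInducedPath k G χ ↔ ∃ node : Fin (k + 1) → V, (∀ c, χ (node c) = c) ∧
      Nonempty (SimpleGraph.pathGraph (k + 1) ≃g G.comap node) := by
  constructor
  · rintro ⟨f, hf⟩
    let color : Fin (k + 1) ≃ Fin (k + 1) := Equiv.ofBijective _ hf.bijective_of_finite
    refine ⟨fun c => f (color.symm c), color.apply_symm_apply, ⟨color, fun {p q} => ?_⟩⟩
    simp only [SimpleGraph.comap_adj, Equiv.symm_apply_apply, f.map_adj_iff]
  · rintro ⟨node, hnode, ⟨e⟩⟩
    have injective : Function.Injective node := Function.LeftInverse.injective hnode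
    refine ⟨e.toEmbedding.trans (SimpleGraph.Embedding.comap ⟨node, injective⟩ G), fun p q h => ?_⟩
    have color_eq : χ (node (e p)) = χ (node (e q)) := h
    rw [hnode, hnode] at color_eq
    exact e.injective color_eq

lemma not_adj_of_iso_pathGraph {V : Type*} {m : ℕ} {H : SimpleGraph V}
    (e : H ≃g SimpleGraph.pathGraph m) {a b c : V} (hab : H.Adj a b) (hbc : H.Adj b c) :
    ¬ H.Adj a c := by
  simp only [← e.map_adj_iff, SimpleGraph.pathGraph_adj] at *
  omega

lemma eq_of_adj_of_iso_pathGraph {V : Type*} {m : ℕ} {H : SimpleGraph V}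
    (e : H ≃g SimpleGraph.pathGraph m) {a b c d : V} (hb : H.Adj a b) (hc : H.Adj a c)
    (hd : H.Adj a d) : b = c ∨ b = d ∨ c = d := by
  simp only [← e.map_adj_iff, SimpleGraph.pathGraph_adj, ← e.injective.eq_iff, Fin.ext_iff] at *
  omega

/-- A graph that consists of the edges of the path `0, …, k` other than `12` and `45`, and of some
of the edges `12`, `45`, `24` and `15`. Such are the graphs that the gadget below induces on one
node of each color. -/
structure IsPathVariant {k : ℕ} (H : SimpleGraph (Fin (k + 1))) : Prop where
  adj_succ : ∀ {a b : Fin (k + 1)}, (b : ℕ) = a + 1 → (a : ℕ) ≠ 1 → (a : ℕ) ≠ 4 → H.Adj a b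
  of_adj : ∀ {a b : Fin (k + 1)}, H.Adj a b → a ≤ b →
    (b : ℕ) = a + 1 ∨ ((a : ℕ) = 2 ∧ (b : ℕ) = 4) ∨ ((a : ℕ) = 1 ∧ (b : ℕ) = 5)

namespace IsPathVariant

variable {k : ℕ} {H : SimpleGraph (Fin (k + 1))} {c₁ c₂ c₄ c₅ : Fin (k + 1)}

lemma exists_adj_boundary (hH : IsPathVariant H) (connected : H.Preconnected)
    (S : Set (Fin (k + 1))) {a b : Fin (k + 1)} (ha : a ∈ S) (hb : b ∉ S) :
    ∃ u v, H.Adj u v ∧ (u ∈ S ↔ v ∉ S) ∧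
      ((v : ℕ) = u + 1 ∨ ((u : ℕ) = 2 ∧ (v : ℕ) = 4) ∨ ((u : ℕ) = 1 ∧ (v : ℕ) = 5)) := by
  obtain ⟨p⟩ := connected a b
  obtain ⟨d, -, hd, hd'⟩ := p.exists_boundary_dart S ha hb
  rcases le_total d.fst d.snd with hle | hle
  · exact ⟨d.fst, d.snd, d.adj, iff_of_true hd hd', hH.of_adj d.adj hle⟩
  · exact ⟨d.snd, d.fst, d.adj.symm, iff_of_false hd' (not_not.2 hd), hH.of_adj d.adj.symm hle⟩

lemma adj_or_adj (hH : IsPathVariant H) (connected : H.Preconnected) (h₁ : (c₁ : ℕ) = 1)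
    (h₂ : (c₂ : ℕ) = 2) (h₄ : (c₄ : ℕ) = 4) (h₅ : (c₅ : ℕ) = 5) :
    (H.Adj c₁ c₂ ∨ H.Adj c₁ c₅) ∧ (H.Adj c₁ c₂ ∨ H.Adj c₄ c₅) ∧ (H.Adj c₄ c₅ ∨ H.Adj c₁ c₅) := by
  refine ⟨?_, ?_, ?_⟩
  · obtain ⟨u, v, hadj, hS, h⟩ := hH.exists_adj_boundary connected {a | (a : ℕ) ≤ 1}
      (a := c₁) (b := c₂) (by simp [h₁]) (by simp [h₂])
    simp only [Set.mem_ofPred_eq] at hS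
    grind
  · obtain ⟨u, v, hadj, hS, h⟩ := hH.exists_adj_boundary connected
      {a | 2 ≤ (a : ℕ) ∧ (a : ℕ) ≤ 4} (a := c₂) (b := c₁) (by simp [h₂]) (by simp [h₁])
    simp only [Set.mem_ofPred_eq] at hS
    grind
  · obtain ⟨u, v, hadj, hS, h⟩ := hH.exists_adj_boundary connected {a | 5 ≤ (a : ℕ)}
      (a := c₅) (b := c₄) (by simp [h₅]) (by simp [h₄])
    simp only [Set.mem_ofPred_eq] at hS
    grind

lemma eq_pathGraph (hH : IsPathVariant H) (hk : 6 ≤ k)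
    (e : H ≃g SimpleGraph.pathGraph (k + 1)) : H = SimpleGraph.pathGraph (k + 1) := by
  have exists_val (i : ℕ) (hi : i ≤ 6) : ∃ a : Fin (k + 1), (a : ℕ) = i := ⟨⟨i, by omega⟩, rfl⟩
  obtain ⟨c₀, h₀⟩ := exists_val 0 (by norm_num)
  obtain ⟨c₁, h₁⟩ := exists_val 1 (by norm_num)
  obtain ⟨c₂, h₂⟩ := exists_val 2 (by norm_num)
  obtain ⟨c₃, h₃⟩ := exists_val 3 (by norm_num)
  obtain ⟨c₄, h₄⟩ := exists_val 4 (by norm_num)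
  obtain ⟨c₅, h₅⟩ := exists_val 5 (by norm_num)
  obtain ⟨c₆, h₆⟩ := exists_val 6 (by norm_num)
  have adj₀₁ : H.Adj c₀ c₁ := hH.adj_succ (by omega) (by omega) (by omega)
  have adj₂₃ : H.Adj c₂ c₃ := hH.adj_succ (by omega) (by omega) (by omega)
  have adj₃₄ : H.Adj c₃ c₄ := hH.adj_succ (by omega) (by omega) (by omega)
  have adj₅₆ : H.Adj c₅ c₆ := hH.adj_succ (by omega) (by omega) (by omega)
  have not_adj₂₄ : ¬ H.Adj c₂ c₄ := not_adj_of_iso_pathGraph e adj₂₃ adj₃₄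
  obtain ⟨leave₀₁, leave₂₃₄, enter₅⟩ := hH.adj_or_adj
    (e.preconnected_iff.2 (SimpleGraph.pathGraph_preconnected _)) h₁ h₂ h₄ h₅
  have not_adj₁₅ : ¬ H.Adj c₁ c₅ := fun adj₁₅ => by
    rcases leave₂₃₄ with adj₁₂ | adj₄₅
    · have := eq_of_adj_of_iso_pathGraph e adj₀₁.symm adj₁₂ adj₁₅
      simp only [Fin.ext_iff] at this
      omega
    · have := eq_of_adj_of_iso_pathGraph e adj₁₅.symm adj₄₅.symm adj₅₆
      simp only [Fin.ext_iff] at this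
      omega
  have adj_iff {a b : Fin (k + 1)} (hab : a ≤ b) : H.Adj a b ↔ (b : ℕ) = a + 1 := by
    have := @hH.of_adj a b
    have := @hH.adj_succ a b
    grind
  ext a b
  rw [SimpleGraph.pathGraph_adj]
  rcases le_total a b with hab | hab
  · rw [adj_iff hab]
    omega
  · rw [H.adj_comm, adj_iff hab]
    omega

end IsPathVariant

/-- The edges of the gadget, directed from smaller to larger colors. Each node has a color and an
index. Consecutive color classes are joined completely, except that the classes `1, 2` and `4, 5`
are joined by the matching of equal indices; the classes `2, 4` and `1, 5` are joined by the
complements of the bipartite graphs `x` and `y` on the indices. -/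
def GadgetRel {V α : Type*} {k : ℕ} (χ : V → Fin (k + 1)) (idx : V → α) (x y : Set (α × α))
    (u v : V) : Prop :=
  ((χ v : ℕ) = χ u + 1 ∧ ((χ u : ℕ) = 1 ∨ (χ u : ℕ) = 4 → idx u = idx v)) ∨
  ((χ u : ℕ) = 2 ∧ (χ v : ℕ) = 4 ∧ (idx u, idx v) ∉ x) ∨
  ((χ u : ℕ) = 1 ∧ (χ v : ℕ) = 5 ∧ (idx u, idx v) ∉ y)

/-- The graph of the reduction from disjointness: its multicolored induced paths run through the
colors in increasing order, and they pick an index `j` in the classes `1, 2` and an index `i` in the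
classes `4, 5` such that `(j, i)` belongs to `x` and to `y`. -/
def gadget {V α : Type*} {k : ℕ} (χ : V → Fin (k + 1)) (idx : V → α) (x y : Set (α × α)) :
    SimpleGraph V :=
  SimpleGraph.fromRel (GadgetRel χ idx x y)

variable {V α : Type*} {k : ℕ} {χ : V → Fin (k + 1)} {idx : V → α} {x y : Set (α × α)}

lemma gadget_adj {u v : V} :
    (gadget χ idx x y).Adj u v ↔ GadgetRel χ idx x y u v ∨ GadgetRel χ idx x y v u := by
  rw [gadget, SimpleGraph.fromRel_adj, and_iff_right_iff_imp]
  rintro h rfl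
  simp only [GadgetRel] at h
  omega

lemma gadget_adj_of_le {u v : V} (h : χ u ≤ χ v) :
    (gadget χ idx x y).Adj u v ↔ GadgetRel χ idx x y u v := by
  rw [gadget_adj, or_iff_left]
  rw [Fin.le_def] at h
  unfold GadgetRel
  omega

lemma hasMulticoloredInducedPath_gadget {j i : α} (hj : ∀ c, ∃ v, χ v = c ∧ idx v = j)
    (hi : ∀ c, ∃ v, χ v = c ∧ idx v = i) (hx : (j, i) ∈ x) (hy : (j, i) ∈ y) :
    HasMulticoloredInducedPath k (gadget χ idx x y) χ := by
  have exists_node (c : Fin (k + 1)) : ∃ v, χ v = c ∧ idx v = if (c : ℕ) ≤ 3 then j else i := by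
    split_ifs
    exacts [hj c, hi c]
  choose node color_node idx_node using exists_node
  have rel_iff (a b : Fin (k + 1)) : GadgetRel χ idx x y (node a) (node b) ↔ (a : ℕ) + 1 = b := by
    simp only [GadgetRel, color_node, idx_node]
    constructor
    · rintro (h | ⟨ha, hb, h⟩ | ⟨ha, hb, h⟩)
      · exact h.1.symm
      · simp [ha, hb, hx] at h
      · simp [ha, hb, hy] at h
    · refine fun h => Or.inl ⟨h.symm, ?_⟩
      rintro (ha | ha) <;> simp [ha, ← h]
  have comap_eq : (gadget χ idx x y).comap node = SimpleGraph.pathGraph (k + 1) := by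
    ext a b
    rw [SimpleGraph.comap_adj, gadget_adj, rel_iff, rel_iff, SimpleGraph.pathGraph_adj]
  exact hasMulticoloredInducedPath_iff.2 ⟨node, color_node, comap_eq ▸ ⟨SimpleGraph.Iso.refl⟩⟩

lemma exists_mem_of_hasMulticoloredInducedPath_gadget (hk : 6 ≤ k)
    (h : HasMulticoloredInducedPath k (gadget χ idx x y) χ) : ∃ p, p ∈ x ∧ p ∈ y := by
  obtain ⟨node, color_node, ⟨e⟩⟩ := hasMulticoloredInducedPath_iff.1 h
  have adj_iff (a b : Fin (k + 1)) (hab : a ≤ b) :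
      ((gadget χ idx x y).comap node).Adj a b ↔ GadgetRel χ idx x y (node a) (node b) :=
    gadget_adj_of_le (by simpa only [color_node] using hab)
  have isPathVariant : IsPathVariant ((gadget χ idx x y).comap node) := by
    refine ⟨fun {a b} hab ha₁ ha₄ => (adj_iff a b (by omega)).2 (Or.inl ?_), fun {a b} h hab => ?_⟩
    · simp only [color_node]
      omega
    · have := (adj_iff a b hab).1 h
      simp only [GadgetRel, color_node] at this
      omega
  have rel_iff (a b : ℕ) (ha : a < k + 1) (hb : b < k + 1) (hab : a ≤ b) :
      GadgetRel χ idx x y (node ⟨a, ha⟩) (node ⟨b, hb⟩) ↔ b = a + 1 := by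
    rw [← adj_iff _ _ hab, isPathVariant.eq_pathGraph hk e.symm, SimpleGraph.pathGraph_adj]
    simp only
    omega
  have rel₁₂ := rel_iff 1 2 (by omega) (by omega) (by norm_num)
  have rel₄₅ := rel_iff 4 5 (by omega) (by omega) (by norm_num)
  have rel₂₄ := rel_iff 2 4 (by omega) (by omega) (by norm_num)
  have rel₁₅ := rel_iff 1 5 (by omega) (by omega) (by norm_num)
  simp only [GadgetRel, color_node] at rel₁₂ rel₄₅ rel₂₄ rel₁₅
  norm_num at rel₁₂ rel₄₅ rel₂₄ rel₁₅
  exact ⟨_, rel₂₄, by rwa [← rel₁₂, rel₄₅]⟩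

end Gadget

section GadgetCut

variable {V α : Type*} {k : ℕ} [Fintype V] [DecidableEq α] {χ : V → Fin (k + 1)} {idx : V → α}

/-- The edges of the gadget between the color classes `2, 3, 4` and the others, in both
orientations: the matchings between the classes `1, 2` and between the classes `4, 5`. -/
def gadgetCut (χ : V → Fin (k + 1)) (idx : V → α) : Finset (V × V) :=
  {e | idx e.1 = idx e.2 ∧
    (((χ e.1 : ℕ) = 1 ∧ (χ e.2 : ℕ) = 2) ∨ ((χ e.1 : ℕ) = 2 ∧ (χ e.2 : ℕ) = 1) ∨
      ((χ e.1 : ℕ) = 4 ∧ (χ e.2 : ℕ) = 5) ∨ ((χ e.1 : ℕ) = 5 ∧ (χ e.2 : ℕ) = 4))}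

lemma card_gadgetCut_le (injective : Function.Injective fun v => (χ v, idx v)) :
    #(gadgetCut χ idx) ≤ Fintype.card V := by
  refine card_le_card_of_injOn Prod.fst (fun _ _ => mem_univ _) ?_
  rintro ⟨u, v⟩ huv ⟨u', v'⟩ huv' (rfl : u = u')
  simp only [gadgetCut, coe_filter, mem_univ, true_and, Set.mem_ofPred_eq] at huv huv'
  have color_eq : χ v = χ v' := by omega
  rw [injective (Prod.ext color_eq (huv.1.symm.trans huv'.1))]

lemma isCutFamily_gadget :
    IsCutFamily (gadget χ idx) {v | 2 ≤ (χ v : ℕ) ∧ (χ v : ℕ) ≤ 4} (gadgetCut χ idx) where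
  adj_left x y y' u v hu := by
    have ne_one : (χ u : ℕ) ≠ 1 := by grind
    have ne_five : (χ u : ℕ) ≠ 5 := by grind
    simp only [gadget_adj, GadgetRel, ne_one, ne_five, false_and, and_false, or_false]
  adj_right x x' y u v hu := by
    have ne_two : (χ u : ℕ) ≠ 2 := by grind
    have ne_four : (χ u : ℕ) ≠ 4 := by grind
    simp only [gadget_adj, GadgetRel, ne_two, ne_four, false_and, and_false, false_or]
  mem_cut {x y u v} hadj hside := by
    simp only [gadget_adj, GadgetRel] at hadj
    simp only [Set.mem_ofPred_eq] at hside
    simp only [gadgetCut, mem_filter, mem_univ, true_and]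
    grind

end GadgetCut

section LowerBound

lemma hasMulticoloredInducedPath_gadget_iff {V α : Type*} {k : ℕ} {χ : V → Fin (k + 1)}
    {idx : V → α} (hk : 6 ≤ k) {s : Finset α} (hs : ∀ i ∈ s, ∀ c, ∃ v, χ v = c ∧ idx v = i)
    (x y : Finset (s × s)) :
    HasMulticoloredInducedPath k
      (gadget χ idx (Prod.map (↑) (↑) '' (x : Set (s × s)))
        (Prod.map (↑) (↑) '' (y : Set (s × s)))) χ ↔
      ¬ Disjoint x y := by
  have injective : Function.Injective (Prod.map (↑) (↑) : s × s → α × α) :=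
    Subtype.val_injective.prodMap Subtype.val_injective
  rw [not_disjoint_iff]
  constructor
  · intro h
    obtain ⟨-, ⟨p, hpx, rfl⟩, hpy⟩ := exists_mem_of_hasMulticoloredInducedPath_gadget hk h
    exact ⟨p, hpx, injective.mem_set_image.1 hpy⟩
  · rintro ⟨⟨j, i⟩, hx, hy⟩
    exact hasMulticoloredInducedPath_gadget (hs j j.2) (hs i i.2) ⟨_, hx, rfl⟩ ⟨_, hy, rfl⟩

variable {Ω : Type} [MeasurableSpace Ω] {μ : Measure Ω} [IsProbabilityMeasure μ] {k n B T : ℕ}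
  {A : CongestAlgorithm (Fin (k + 1)) n B Ω}

lemma CongestAlgorithm.Solves.exp_card_sq_le (hA : A.Solves μ (HasMulticoloredInducedPath k) T)
    (hk : 6 ≤ k) {α : Type} {χ : Fin n → Fin (k + 1)} {idx : Fin n → α}
    (injective : Function.Injective fun v => (χ v, idx v)) {s : Finset α} (nonempty : s.Nonempty)
    (hs : ∀ i ∈ s, ∀ c, ∃ v, χ v = c ∧ idx v = i) :
    Real.exp ((#s : ℝ) ^ 2 / 46208) ≤ 616 * 3 ^ (B * n * T) := by
  classical
  have : Nonempty s := nonempty.to_subtype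
  have isCutFamily : IsCutFamily
      (fun x y : Finset (s × s) => gadget χ idx (Prod.map (↑) (↑) '' (x : Set (s × s)))
        (Prod.map (↑) (↑) '' (y : Set (s × s))))
      {v | 2 ≤ (χ v : ℕ) ∧ (χ v : ℕ) ≤ 4} (gadgetCut χ idx) :=
    isCutFamily_gadget.comp _ _
  have card_cut := card_gadgetCut_le injective
  rw [Fintype.card_fin] at card_cut
  calc Real.exp ((#s : ℝ) ^ 2 / 46208) = Real.exp (Fintype.card (s × s) / 46208) := by
        rw [Fintype.card_prod, Fintype.card_coe, Nat.cast_mul, sq]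
    _ ≤ 616 * 3 ^ (B * #(gadgetCut χ idx) * T) :=
        hA.exp_le isCutFamily (hasMulticoloredInducedPath_gadget_iff hk hs)
    _ ≤ 616 * 3 ^ (B * n * T) := by
        gcongr
        norm_num

lemma CongestAlgorithm.Solves.exp_sq_div_le (hA : A.Solves μ (HasMulticoloredInducedPath k) T)
    (hk : 6 ≤ k) (hn : k + 1 ≤ n) :
    Real.exp (((n / (k + 1) : ℕ) : ℝ) ^ 2 / 46208) ≤ 616 * 3 ^ (B * n * T) := by
  have injective : Function.Injective fun v : Fin n =>
      (Fin.ofNat (k + 1) (v : ℕ), (v : ℕ) / (k + 1)) := by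
    intro u v h
    obtain ⟨color_eq, idx_eq⟩ := Prod.ext_iff.1 h
    rw [Fin.ext_iff] at color_eq ⊢
    rw [← Nat.div_add_mod (u : ℕ) (k + 1), ← Nat.div_add_mod (v : ℕ) (k + 1)]
    exact congrArg₂ (fun q r => (k + 1) * q + r) idx_eq color_eq
  have exists_node (i : ℕ) (hi : i ∈ range (n / (k + 1))) (c : Fin (k + 1)) :
      ∃ v : Fin n, Fin.ofNat (k + 1) (v : ℕ) = c ∧ (v : ℕ) / (k + 1) = i := by
    have hlt : i * (k + 1) + c < n := calc
      i * (k + 1) + c < (i + 1) * (k + 1) := by linarith [c.isLt]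
      _ ≤ n / (k + 1) * (k + 1) := Nat.mul_le_mul_right _ (mem_range.1 hi)
      _ ≤ n := Nat.div_mul_le_self n (k + 1)
    refine ⟨⟨i * (k + 1) + c, hlt⟩, Fin.ext ?_, ?_⟩
    · simp [Fin.ofNat, Nat.mul_add_mod_self_right, Nat.mod_eq_of_lt c.isLt]
    · simp [Nat.add_div_of_dvd_right, Nat.div_eq_of_lt c.isLt]
  have nonempty : (range (n / (k + 1))).Nonempty :=
    nonempty_range_iff.2 (Nat.div_pos hn k.succ_pos).ne'
  simpa only [card_range] using hA.exp_card_sq_le hk injective nonempty exists_node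

lemma CongestAlgorithm.Solves.sq_le (hA : A.Solves μ (HasMulticoloredInducedPath k) T)
    (hk : 6 ≤ k) (hn : k + 1 ≤ n) :
    (n : ℝ) ^ 2 ≤ 4 * (k + 1) ^ 2 * 46208 * (615 + 2 * (B * n * T)) := by
  have n_le : (n : ℝ) ≤ 2 * (k + 1) * (n / (k + 1) : ℕ) := by
    have := Nat.div_pos hn k.succ_pos
    have := Nat.lt_mul_div_succ n k.succ_pos
    exact_mod_cast (show n ≤ 2 * (k + 1) * (n / (k + 1)) by nlinarith)
  have sq_div_le : ((n / (k + 1) : ℕ) : ℝ) ^ 2 / 46208 ≤ 615 + 2 * (B * n * T) := calc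
    ((n / (k + 1) : ℕ) : ℝ) ^ 2 / 46208 ≤ Real.log (616 * 3 ^ (B * n * T)) := by
        rw [Real.le_log_iff_exp_le (by positivity)]
        exact hA.exp_sq_div_le hk hn
    _ = Real.log 616 + (B * n * T) * Real.log 3 := by
        rw [Real.log_mul (by norm_num) (by positivity), Real.log_pow]
        push_cast
        rfl
    _ ≤ (616 - 1) + (B * n * T) * (3 - 1) := by
        gcongr <;> exact Real.log_le_sub_one_of_pos (by norm_num)
    _ = 615 + 2 * (B * n * T) := by ring
  calc (n : ℝ) ^ 2 ≤ (2 * (k + 1) * (n / (k + 1) : ℕ)) ^ 2 := by gcongr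
    _ = 4 * (k + 1) ^ 2 * 46208 * (((n / (k + 1) : ℕ) : ℝ) ^ 2 / 46208) := by ring
    _ ≤ 4 * (k + 1) ^ 2 * 46208 * (615 + 2 * (B * n * T)) := by gcongr

end LowerBound

theorem mainTheorem12_general (k : ℕ) (hk : 6 ≤ k) :
    ∃ c : ℝ, 0 < c ∧ ∃ n₀ : ℕ, ∀ n : ℕ, n₀ ≤ n → ∀ (B : ℕ) (Ω : Type) [MeasurableSpace Ω]
      (μ : Measure Ω) [IsProbabilityMeasure μ] (A : CongestAlgorithm (Fin (k + 1)) n B Ω) (T : ℕ),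
      A.Solves μ (HasMulticoloredInducedPath k) T → c * n ≤ (B : ℝ) * T := by
  set K : ℕ := 4 * (k + 1) ^ 2 * 46208 with hK
  have hk_le : k + 1 ≤ K := by nlinarith
  refine ⟨1 / (4 * K), by positivity, 1230 * K, fun n hn B Ω _ μ _ A T hA => ?_⟩
  have n_pos : 0 < (n : ℝ) := by
    exact_mod_cast (show 0 < n by omega)
  have hn' : 1230 * (K : ℝ) ≤ n := by exact_mod_cast hn
  have sq_le : (n : ℝ) ^ 2 ≤ K * (615 + 2 * (B * n * T)) := by
    exact_mod_cast hA.sq_le hk (by omega)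
  have n_le_sq : (n : ℝ) ≤ n ^ 2 := by exact_mod_cast Nat.le_self_pow two_ne_zero n
  have : (n : ℝ) * n ≤ n * (4 * K * (B * T)) := by linarith
  rw [div_mul_eq_mul_div, one_mul, div_le_iff₀' (by positivity)]
  exact le_of_mul_le_mul_left this n_pos

theorem mainTheorem12 (k : ℕ) (hk : 6 ≤ k) (β : ℝ) (hβ : 0 < β) :
    ∃ c : ℝ, 0 < c ∧ ∃ n₀ : ℕ, ∀ n : ℕ, n₀ ≤ n → ∀ B : ℕ, (B : ℝ) ≤ β * Real.log n →
      ∀ (Ω : Type) [MeasurableSpace Ω] (μ : Measure Ω) [IsProbabilityMeasure μ]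
        (A : CongestAlgorithm (Fin (k + 1)) n B Ω) (T : ℕ),
        A.Solves μ (HasMulticoloredInducedPath k) T →
          c * ((n : ℝ) / Real.log n) ≤ (T : ℝ) := by
  obtain ⟨c, hc, n₀, h⟩ := mainTheorem12_general k hk
  refine ⟨c / β, by positivity, n₀, fun n hn B hB Ω _ μ _ A T hA => ?_⟩
  have c_mul_le : c * n ≤ T * (β * Real.log n) :=
    (h n hn B Ω μ A T hA).trans (by rw [mul_comm]; gcongr)
  rw [div_mul_div_comm]
  exact div_le_of_le_mul₀ (mul_nonneg hβ.le (Real.log_natCast_nonneg n)) T.cast_nonneg c_mul_le
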